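/- **Setting.** Let $d\ge 1$, $A=\{0,1,\dots,d\}$, let $X\subset\mathbb R$ be compact and connected, and let $f_a:X\to \operatorname{Int}X$ $(a\in A)$ be differentiable contractions with $f_a'>0$ and with pairwise disjoint images $f_a(X)$, labelled so that $f_0(X)$ is the leftmost and $f_1(X)$ the rightmost of these images. Assume that there are $\epsilon>0$ and an open interval $Y\supset X$ such that each $f_a$ has a $C^{1+\epsilon}$-continuation $\tilde f_a$ to $Y$ which maps $Y$ diffeomorphically onto a subset $\tilde f_a(Y)\subset Y$. Let $\mathcal L=\bigcap_{n}\bigcup_{\omega\in A^n}f_\omega(X)$ be the limit set, where $f_{x_1\ldots x_n}=f_{x_1}\circ\dots\circ f_{x_n}$, and identify $(x_1x_2\ldots)\in A^{\mathbb N}$ with the point $\xi\in\mathcal L$ given by $\{\xi\}=\bigcap_n f_{x_1\ldots x_n}(X)$. Let $\sigma$ be the left shift, $S_ng=\sum_{k=0}^{n-1}g\circ\sigma^k$, let $[\omega]\subset\mathcal L$ be the set of points whose code starts with the word $\omega$, and let $\phi(\xi)=\log f_{x_1}'(\sigma\xi)$ be the geometric potential. Let $\alpha>0$ and let $\psi:\mathcal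 L\to\mathbb R$ be Hölder continuous with $\alpha\phi<\psi<0$ and with pressure $P(\psi)=\lim_{n}\frac1n\log\sum_{\omega\in A^n}\exp(\sup_{\xi\in[\omega]}S_n\psi(\xi))=0$. Put $\chi_\alpha=\psi-\alpha\phi$. Let $\nu_\psi$ be a Gibbs measure for $\psi$, that is, a Borel probability measure on $\mathbb R$ with $\nu_\psi(\mathcal L)=1$ for which there is $c>0$ with $c^{-1}e^{S_n\psi(\xi)}\le\nu_\psi([\omega])\le c\,e^{S_n\psi(\xi)}$ for all $n$, $\omega\in A^n$ and $\xi\in[\omega]$; let $F_\psi(x)=\nu_\psi((-\infty,x])$. For $i\in\{0,1\}$ let $\underline i$ be the infinite word all of whose letters are $i$. For integers $n,k\ge1$, a point $\xi=(x_1x_2\ldots)\in\mathcal L$ has an $i$-block of length $k$ at the $n$-th level if $x_n\ne i$, $x_{n+k+1}\neq i$, and $x_{n+m}=i$ for all $1\le m\le k$. **Proposition.** There is a constant $C>0$ (depending only on the system, $\alpha$, $\psi$ and $\nu_\psi$) such that for all $i\in\{0,1\}$, all integers $n,k\ge1$ and every $\xi\in\mathcal L$ which has an $i$-block of length $k$ at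 the $n$-th level, there exists $\eta\in\mathcal L$ with $$C^{-1}e^{S_n\phi(\xi)}\le|\xi-\eta|\le C\,e^{S_n\phi(\xi)}$$ and $$C^{-1}e^{S_n\chi_\alpha(\xi)}e^{k\psi(\underline i)}\le\frac{|F_\psi(\xi)-F_\psi(\eta)|}{|\xi-\eta|^\alpha}\le C\,e^{S_n\chi_\alpha(\xi)}e^{k\psi(\underline i)}.$$ -/

import Mathlib

/-- A finitely generated conformal iterated function system on a compact interval `X` of the real
line, with alphabet `{0, 1, …, d}`.  Only the values of `f a` on `X` matter. -/
structure ConformalIFS (d : ℕ) where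
  /-- the compact connected set on which the contractions act -/
  X : Set ℝ
  /-- the generators -/
  f : Fin (d + 1) → ℝ → ℝ
  isCompact_X : IsCompact X
  isConnected_X : IsConnected X
  contraction : ∀ a, ∃ c : NNReal, c < 1 ∧ LipschitzOnWith c (f a) X
  mapsTo_interior : ∀ a, Set.MapsTo (f a) X (interior X)
  /-- strong separation condition -/
  separation : ∀ a b, a ≠ b → Disjoint (f a '' X) (f b '' X)
  /-- Hölder condition: the generators have `C^{1+ε}` continuations to an open interval `Y ⊇ X`
  which map `Y` into itself and are diffeomorphisms onto their images. -/
  holder : ∃ (ε : NNReal) (Y : Set ℝ), 0 < ε ∧ IsOpen Y ∧ Y.OrdConnected ∧ X ⊆ Y ∧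
    ∀ a, ∃ g : ℝ → ℝ, Set.EqOn g (f a) X ∧ Set.MapsTo g Y Y ∧
      ContDiffOn ℝ 1 g Y ∧ (∃ C : NNReal, HolderOnWith C ε (deriv g) Y) ∧
      Set.InjOn g Y ∧ ∀ y ∈ Y, deriv g y ≠ 0
  /-- the generators preserve orientation, so that the logarithm of the derivative makes sense -/
  deriv_pos : ∀ a, ∀ x ∈ interior X, 0 < deriv (f a) x
  /-- the letter `0` labels the utter left interval -/
  label_left : ∀ a, a ≠ 0 → ∀ ξ ∈ f 0 '' X, ∀ η ∈ f a '' X, ξ < η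
  /-- the letter `1` labels the utter right interval -/
  label_right : ∀ a, a ≠ 1 → ∀ ξ ∈ f 1 '' X, ∀ η ∈ f a '' X, η < ξ

namespace ConformalIFS

/-- The left shift on the code space.  A sequence `x : ℕ → Fin (d + 1)` stands for the infinite
word `x₁ x₂ x₃ …` with `x₁ = x 0`, `x₂ = x 1`, and so on. -/
def shift {d : ℕ} (x : ℕ → Fin (d + 1)) : ℕ → Fin (d + 1) := fun n => x (n + 1)

/-- The cylinder set of a finite word, in the code space. -/
def cylinder {d n : ℕ} (w : Fin n → Fin (d + 1)) : Set (ℕ → Fin (d + 1)) :=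
  {x | ∀ j : Fin n, x j = w j}

/-- `x` has an `i`-block of length `k` at the `n`-th level: the `n`-th and the `(n+k+1)`-st letters
of the word differ from `i`, and the `k` letters in between are all equal to `i`. -/
def HasBlock {d : ℕ} (x : ℕ → Fin (d + 1)) (i : Fin (d + 1)) (k n : ℕ) : Prop :=
  1 ≤ n ∧ 1 ≤ k ∧ x (n - 1) ≠ i ∧ x (n + k) ≠ i ∧ ∀ m, 1 ≤ m → m ≤ k → x (n + m - 1) = i

/-- `p` is the topological pressure of the potential `g` on the code space. -/
def HasPressure {d : ℕ} (g : (ℕ → Fin (d + 1)) → ℝ) (p : ℝ) : Prop :=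
  Filter.Tendsto
    (fun n : ℕ => (1 / (n : ℝ)) * Real.log (∑ w : Fin n → Fin (d + 1),
      Real.exp (sSup ((fun x => birkhoffSum shift g n x) '' cylinder w))))
    Filter.atTop (nhds p)

variable {d : ℕ} (F : ConformalIFS d)

/-- `f_ω = f_{x₁} ∘ … ∘ f_{xₙ}` for a finite word `ω = x₁ … xₙ`. -/
def wordMap : List (Fin (d + 1)) → ℝ → ℝ
  | [] => id
  | a :: w => F.f a ∘ wordMap w

/-- The limit set of the iterated function system. -/
def limitSet : Set ℝ :=
  ⋂ n : ℕ, ⋃ w : Fin n → Fin (d + 1), F.wordMap (List.ofFn w) '' F.X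

/-- The nested intersection of the sets `f_{x₁ … xₙ}(X)`. -/
def nest (x : ℕ → Fin (d + 1)) : Set ℝ :=
  ⋂ n : ℕ, F.wordMap (List.ofFn fun j : Fin n => x j) '' F.X

/-- The coding map: `F.code x` is the only point of the nested intersection `F.nest x`
(see `nest_eq`). -/
noncomputable def code (x : ℕ → Fin (d + 1)) : ℝ := sInf (F.nest x)

/-- The geometric potential `φ(x₁ x₂ …) = log f'_{x₁}(x₂ x₃ …)`, as a function of the code. -/
noncomputable def geomPotential (x : ℕ → Fin (d + 1)) : ℝ :=
  Real.log (deriv (F.f (x 0)) (F.code (shift x)))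

/-- A potential `ψ` on the limit set, read as a function of the code. -/
noncomputable def lift (ψ : ℝ → ℝ) (x : ℕ → Fin (d + 1)) : ℝ := ψ (F.code x)

/-- The potential `χ_α = ψ - α φ`, as a function of the code. -/
noncomputable def chi (ψ : ℝ → ℝ) (α : ℝ) (x : ℕ → Fin (d + 1)) : ℝ :=
  F.lift ψ x - α * F.geomPotential x

/-- `ν` is a Gibbs measure for the potential `ψ` of pressure zero: a Borel probability measure
carried by the limit set such that `ν([ω])` is comparable to `exp (S_n ψ(ξ))`, uniformly over all
finite words `ω` of any length `n` and all `ξ ∈ [ω]`. -/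
structure IsGibbs (ψ : ℝ → ℝ) (ν : MeasureTheory.Measure ℝ) : Prop where
  prob : MeasureTheory.IsProbabilityMeasure ν
  carried : ν F.limitSetᶜ = 0
  gibbs : ∃ C : ℝ, 0 < C ∧ ∀ (n : ℕ) (w : Fin n → Fin (d + 1)), ∀ x ∈ cylinder w,
    C⁻¹ * Real.exp (birkhoffSum shift (F.lift ψ) n x) ≤ ν.real (F.code '' cylinder w) ∧
    ν.real (F.code '' cylinder w) ≤ C * Real.exp (birkhoffSum shift (F.lift ψ) n x)

theorem wordMap_mapsTo (w : List (Fin (d + 1))) : Set.MapsTo (F.wordMap w) F.X F.X := by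
  induction w with
  | nil => exact Set.mapsTo_id _
  | cons a w ih => exact fun y hy => interior_subset (F.mapsTo_interior a (ih hy))

theorem exists_ratio : ∃ c : NNReal, c < 1 ∧ ∀ a, LipschitzOnWith c (F.f a) F.X := by
  choose c hc hL using F.contraction
  refine ⟨Finset.univ.sup c, ?_, fun a => (hL a).weaken (Finset.le_sup (Finset.mem_univ a))⟩
  exact (Finset.sup_lt_iff (by simp)).2 fun a _ => hc a

theorem wordMap_lipschitz {c : NNReal} (hc : ∀ a, LipschitzOnWith c (F.f a) F.X)
    (w : List (Fin (d + 1))) : LipschitzOnWith (c ^ w.length) (F.wordMap w) F.X := by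
  induction w with
  | nil => simpa [wordMap] using LipschitzWith.id.lipschitzOnWith
  | cons a w ih =>
    rw [List.length_cons, pow_succ']
    exact (hc a).comp ih (F.wordMap_mapsTo w)

theorem wordMap_append (v w : List (Fin (d + 1))) :
    F.wordMap (v ++ w) = F.wordMap v ∘ F.wordMap w := by
  induction v with
  | nil => rfl
  | cons a v ih => simp [wordMap, ih, Function.comp_assoc]

/-- The coding map is well defined: the nested intersection consists of exactly one point. -/
theorem nest_eq (x : ℕ → Fin (d + 1)) : F.nest x = {F.code x} := by
  obtain ⟨c, hc1, hc⟩ := F.exists_ratio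
  have hne : (F.nest x).Nonempty := by
    apply IsCompact.nonempty_iInter_of_sequence_nonempty_isCompact_isClosed
    · intro n
      rw [List.ofFn_succ', List.concat_eq_append, wordMap_append, Set.image_comp]
      exact Set.image_mono (F.wordMap_mapsTo _).image_subset
    · exact fun n => F.isConnected_X.nonempty.image _
    · simpa [wordMap] using F.isCompact_X
    · intro n
      exact (F.isCompact_X.image_of_continuousOn (F.wordMap_lipschitz hc _).continuousOn).isClosed
  have hsub : (F.nest x).Subsingleton := by
    intro p hp q hq
    obtain ⟨D, hD⟩ := Metric.isBounded_iff.1 F.isCompact_X.isBounded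
    have hle : ∀ n : ℕ, dist p q ≤ (c : ℝ) ^ n * D := by
      intro n
      obtain ⟨u, hu, rfl⟩ := Set.mem_iInter.1 hp n
      obtain ⟨v, hv, rfl⟩ := Set.mem_iInter.1 hq n
      have h := (F.wordMap_lipschitz hc (List.ofFn fun j : Fin n => x j)).dist_le_mul u hu v hv
      simp only [List.length_ofFn, NNReal.coe_pow] at h
      exact h.trans (mul_le_mul_of_nonneg_left (hD hu hv) (by positivity))
    have hlim : Filter.Tendsto (fun n : ℕ => (c : ℝ) ^ n * D) Filter.atTop (nhds (0 * D)) :=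
      (tendsto_pow_atTop_nhds_zero_of_lt_one c.2 (by exact_mod_cast hc1)).mul_const D
    have h0 := ge_of_tendsto' hlim hle
    rw [zero_mul] at h0
    exact dist_le_zero.1 h0
  obtain ⟨p, hp⟩ := hne
  have h := hsub.eq_singleton_of_mem hp
  rw [code, h, csInf_singleton]

end ConformalIFS

namespace ConformalIFS

open Set

/-! ### Symbolic coding of the limit set -/

section Coding

variable {d : ℕ}

/-! The point η is taken just across the gap that bounds the cylinder [x₁…xₙ] on the side of the
extremal letter i. Since xₙ ≠ i, the image of X under xₙ has a nearest neighbour a on that side. The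
code of η is x₁…xₙ₋₁ a i' i' i' …, where i' is the opposite extremal letter, so η is the point of
[x₁…xₙ₋₁a] closest to [x₁…xₙ].

Distance: the codes of ξ and η agree on exactly n-1 letters. After n-1 shifts the two points are
separated by a uniform gap and lie in the bounded set X, so bounded distortion makes |ξ-η|
comparable to exp(Sₙφ(ξ)) (`exists_abs_code_sub_bounds`).

Measure: no point of the limit set lies inside the gap, and every limit point between η and ξ has a
code starting with x₁…xₙiᵏ. Conversely, as the letter of ξ after the block is not i, all of
[x₁…xₙiᵏ⁺¹] lies between η and ξ (`exists_code_beside_block`). By the Gibbs property and the bounded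
variation of Sₙψ, both cylinders have measure comparable to exp(Sₙψ(ξ) + kψ(i i i …)); η carries no
mass because ψ < 0 (`IsGibbs.exists_bounds`). Dividing by |ξ-η|^α turns Sₙψ into the Birkhoff sum of
ψ - αφ. -/

theorem shift_iterate_apply (x : ℕ → Fin (d + 1)) (n j : ℕ) : shift^[n] x j = x (n + j) := by
  induction n generalizing x with
  | zero => simp
  | succ n ih =>
    rw [Function.iterate_succ_apply, ih]
    simp only [shift]
    congr 1
    omega

variable (F : ConformalIFS d)

theorem code_mem_nest (x : ℕ → Fin (d + 1)) : F.code x ∈ F.nest x := by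
  rw [nest_eq]
  exact mem_singleton _

theorem code_mem_X (x : ℕ → Fin (d + 1)) : F.code x ∈ F.X := by
  simpa [wordMap] using mem_iInter.1 (F.code_mem_nest x) 0

theorem code_eq_of_mem_nest {x : ℕ → Fin (d + 1)} {p : ℝ} (h : p ∈ F.nest x) : F.code x = p := by
  rw [nest_eq] at h
  exact (mem_singleton_iff.1 h).symm

theorem code_eq (x : ℕ → Fin (d + 1)) : F.code x = F.f (x 0) (F.code (shift x)) := by
  apply F.code_eq_of_mem_nest
  refine mem_iInter.2 fun n => ?_
  cases n with
  | zero => simpa [wordMap] using interior_subset (F.mapsTo_interior _ (F.code_mem_X (shift x)))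
  | succ n =>
    obtain ⟨u, hu, hu'⟩ := mem_iInter.1 (F.code_mem_nest (shift x)) n
    refine ⟨u, hu, ?_⟩
    rw [List.ofFn_succ]
    exact congrArg (F.f (x 0)) hu'

theorem code_mem_interior (x : ℕ → Fin (d + 1)) : F.code x ∈ interior F.X := by
  rw [code_eq]
  exact F.mapsTo_interior _ (F.code_mem_X _)

theorem code_mem_limitSet (x : ℕ → Fin (d + 1)) : F.code x ∈ F.limitSet :=
  mem_iInter.2 fun n => mem_iUnion.2 ⟨_, mem_iInter.1 (F.code_mem_nest x) n⟩

theorem continuousOn_f (a : Fin (d + 1)) : ContinuousOn (F.f a) F.X := by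
  obtain ⟨c, -, hc⟩ := F.contraction a
  exact hc.continuousOn

theorem ordConnected_X : F.X.OrdConnected := F.isConnected_X.isPreconnected.ordConnected

theorem strictMonoOn_f (a : Fin (d + 1)) : StrictMonoOn (F.f a) F.X :=
  strictMonoOn_of_deriv_pos F.ordConnected_X.convex (F.continuousOn_f a) (F.deriv_pos a)

/-- Every point of the limit set is the image of another one under a generator. -/
theorem exists_preimage_of_mem_limitSet {p : ℝ} (hp : p ∈ F.limitSet) :
    ∃ a, ∃ q ∈ F.limitSet, F.f a q = p := by
  have key : ∀ n : ℕ, ∃ w : Fin (n + 1) → Fin (d + 1),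
      ∃ u ∈ F.wordMap (List.ofFn fun j : Fin n => w j.succ) '' F.X, F.f (w 0) u = p := by
    intro n
    obtain ⟨w, v, hv, rfl⟩ := mem_iUnion.1 (mem_iInter.1 hp (n + 1))
    refine ⟨w, _, mem_image_of_mem _ hv, ?_⟩
    rw [List.ofFn_succ]
    rfl
  obtain ⟨w₀, q, hq, hqp⟩ := key 0
  have hqX : q ∈ F.X := by simpa [wordMap] using hq
  refine ⟨w₀ 0, q, mem_iInter.2 fun n => ?_, hqp⟩
  obtain ⟨w, u, hu, hup⟩ := key n
  have huX : u ∈ F.X := (F.wordMap_mapsTo _).image_subset hu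
  -- The word w depends on n, but separation forces its first letter, and injectivity of the
  -- generator then forces the preimage, so one q serves all levels.
  have hw : w 0 = w₀ 0 := by
    by_contra h
    exact disjoint_left.1 (F.separation _ _ h) ⟨u, huX, hup⟩ ⟨q, hqX, hqp⟩
  have huq : u = q := (F.strictMonoOn_f (w₀ 0)).injOn huX hqX (by rw [hqp, ← hw, hup])
  exact mem_iUnion.2 ⟨_, huq ▸ hu⟩

/-- The coding map is onto the limit set. -/
theorem exists_code_eq {p : ℝ} (hp : p ∈ F.limitSet) : ∃ x, F.code x = p := by
  choose a T hT haT using fun q : F.limitSet => F.exists_preimage_of_mem_limitSet q.2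
  -- S is an inverse branch of the generators; the code of p is its itinerary under S.
  let S : F.limitSet → F.limitSet := fun q => ⟨T q, hT q⟩
  have hX : F.limitSet ⊆ F.X := fun q hq => by
    simpa [wordMap] using mem_iInter.1 hq 0
  refine ⟨fun n => a (S^[n] ⟨p, hp⟩), F.code_eq_of_mem_nest (mem_iInter.2 fun n => ?_)⟩
  suffices h : ∀ q : F.limitSet,
      (q : ℝ) ∈ F.wordMap (List.ofFn fun j : Fin n => a (S^[j] q)) '' F.X from h ⟨p, hp⟩
  induction n with
  | zero => exact fun q => by simpa [wordMap] using hX q.2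
  | succ n ih =>
    intro q
    obtain ⟨u, hu, huq⟩ := ih (S q)
    refine ⟨u, hu, ?_⟩
    rw [List.ofFn_succ]
    exact (congrArg (F.f (a q)) huq).trans (haT q)

end Coding

/-! ### Order of cylinders on the line -/

section Order

variable {d : ℕ} (F : ConformalIFS d) {s : ℝ}

/-- The sign s lets one argument serve both ends of X: with s = -1 the order is reversed and the
rightmost image plays the role of the leftmost. -/
theorem sign_mul_f_lt_iff (hs : s = 1 ∨ s = -1) (a : Fin (d + 1)) {u v : ℝ} (hu : u ∈ F.X)
    (hv : v ∈ F.X) : s * F.f a u < s * F.f a v ↔ s * u < s * v := by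
  rcases hs with rfl | rfl
  · simpa using (F.strictMonoOn_f a).lt_iff_lt hu hv
  · simpa using (F.strictMonoOn_f a).lt_iff_lt hv hu

theorem sign_mul_code_lt_iff (hs : s = 1 ∨ s = -1) {n : ℕ} {x y : ℕ → Fin (d + 1)}
    (h : ∀ j < n, x j = y j) :
    s * F.code x < s * F.code y ↔ s * F.code (shift^[n] x) < s * F.code (shift^[n] y) := by
  induction n generalizing x y with
  | zero => rfl
  | succ n ih =>
    rw [Function.iterate_succ_apply, Function.iterate_succ_apply,
      ← ih (x := shift x) (y := shift y) fun j hj => h (j + 1) (by omega), F.code_eq x,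
      F.code_eq y, h 0 (by omega)]
    exact F.sign_mul_f_lt_iff hs _ (F.code_mem_X _) (F.code_mem_X _)

theorem sign_mul_code_le_iff (hs : s = 1 ∨ s = -1) {n : ℕ} {x y : ℕ → Fin (d + 1)}
    (h : ∀ j < n, x j = y j) :
    s * F.code x ≤ s * F.code y ↔ s * F.code (shift^[n] x) ≤ s * F.code (shift^[n] y) := by
  rw [← not_lt, ← not_lt, F.sign_mul_code_lt_iff hs fun j hj => (h j hj).symm]

/-- Distinct first-level images of `X` are ordered. -/
theorem image_lt_or_lt (hs : s = 1 ∨ s = -1) {a b : Fin (d + 1)} (hab : a ≠ b) :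
    (∀ u ∈ F.X, ∀ v ∈ F.X, s * F.f a u < s * F.f b v) ∨
      ∀ u ∈ F.X, ∀ v ∈ F.X, s * F.f b v < s * F.f a u := by
  by_contra! H
  obtain ⟨⟨u, hu, v, hv, h⟩, u', hu', v', hv', h'⟩ := H
  -- If neither order held, this difference would change sign on the connected set X × X, and a zero
  -- of it would be a common point of the two images.
  have hc : ContinuousOn (fun p : ℝ × ℝ => s * F.f a p.1 - s * F.f b p.2) (F.X ×ˢ F.X) := by
    refine ContinuousOn.sub (continuousOn_const.mul ?_) (continuousOn_const.mul ?_)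
    · exact (F.continuousOn_f a).comp continuousOn_fst fun p hp => hp.1
    · exact (F.continuousOn_f b).comp continuousOn_snd fun p hp => hp.2
  have hpre := F.isConnected_X.isPreconnected.prod F.isConnected_X.isPreconnected
  obtain ⟨p, hp, hp0⟩ := hpre.intermediate_value (a := (u', v')) (b := (u, v)) ⟨hu', hv'⟩
    ⟨hu, hv⟩ hc (show (0 : ℝ) ∈ Icc _ _ from ⟨by simpa using h', by simpa using h⟩)
  have heq : F.f a p.1 = F.f b p.2 := by
    rcases hs with rfl | rfl <;> simp only at hp0 <;> linarith
  exact disjoint_left.1 (F.separation a b hab) ⟨_, hp.1, rfl⟩ ⟨_, hp.2, heq.symm⟩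

/-- If the image of the letter `i` is extremal, then every other letter has a neighbour on the
side of `i`. -/
theorem exists_neighbor (hs : s = 1 ∨ s = -1) {i b : Fin (d + 1)}
    (hi : ∀ a, a ≠ i → ∀ u ∈ F.X, ∀ v ∈ F.X, s * F.f i u < s * F.f a v) (hb : b ≠ i) :
    ∃ a, a ≠ b ∧ (∀ u ∈ F.X, ∀ v ∈ F.X, s * F.f a u < s * F.f b v) ∧
      ∀ c, c ≠ a → c ≠ b → (∀ u ∈ F.X, ∀ v ∈ F.X, s * F.f c u < s * F.f a v) ∨
        ∀ u ∈ F.X, ∀ v ∈ F.X, s * F.f b v < s * F.f c u := by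
  obtain ⟨p, hp⟩ := F.isConnected_X.nonempty
  -- The neighbour is the highest image below that of b. Comparing images at the single point p
  -- suffices, since disjoint images are ordered as wholes.
  obtain ⟨a, ha, hmax⟩ := (Finset.univ.filter fun c => s * F.f c p < s * F.f b p).exists_max_image
    (fun c => s * F.f c p) ⟨i, by simpa using hi b hb p hp p hp⟩
  replace ha : s * F.f a p < s * F.f b p := by simpa using ha
  have hab : a ≠ b := by
    rintro rfl
    exact lt_irrefl _ ha
  refine ⟨a, hab, (F.image_lt_or_lt hs hab).resolve_right fun h => lt_asymm ha (h p hp p hp),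
    fun c hca hcb => ?_⟩
  rcases F.image_lt_or_lt hs hcb with h | h
  · refine Or.inl ((F.image_lt_or_lt hs hca).resolve_right fun h' => ?_)
    exact (hmax c (by simpa using h p hp p hp)).not_gt (h' p hp p hp)
  · exact Or.inr h

/-- Cylinders are order convex. -/
theorem agree_of_between (hs : s = 1 ∨ s = -1) {n : ℕ} {e x y : ℕ → Fin (d + 1)}
    (h : ∀ j < n, e j = x j) (hey : s * F.code e < s * F.code y)
    (hyx : s * F.code y ≤ s * F.code x) : ∀ j < n, y j = x j := by
  induction n generalizing e x y with
  | zero => simp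
  | succ n ih =>
    have h0 : e 0 = x 0 := h 0 (by omega)
    have hy0 : y 0 = x 0 := by
      by_contra hne
      rw [F.code_eq e, F.code_eq y, h0] at hey
      rw [F.code_eq y, F.code_eq x] at hyx
      rcases F.image_lt_or_lt hs hne with h' | h'
      · exact lt_asymm hey (h' _ (F.code_mem_X _) _ (F.code_mem_X _))
      · exact hyx.not_gt (h' _ (F.code_mem_X _) _ (F.code_mem_X _))
    have hey' := (F.sign_mul_code_lt_iff hs (n := 1) (by
      intro j hj
      obtain rfl : j = 0 := by omega
      rw [h0, hy0])).1 hey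
    have hyx' := (F.sign_mul_code_le_iff hs (n := 1) (by
      intro j hj
      obtain rfl : j = 0 := by omega
      rw [hy0])).1 hyx
    have := ih (fun j hj => h (j + 1) (by omega)) hey' hyx'
    intro j hj
    cases j with
    | zero => exact hy0
    | succ j => exact this j (by omega)

/-- Points beyond a point of the extremal cylinder `[i^k]` belong to that cylinder. -/
theorem agree_extremal (hs : s = 1 ∨ s = -1) {i : Fin (d + 1)}
    (hi : ∀ a, a ≠ i → ∀ u ∈ F.X, ∀ v ∈ F.X, s * F.f i u < s * F.f a v) {k : ℕ}
    {x y : ℕ → Fin (d + 1)} (hx : ∀ j < k, x j = i) (hyx : s * F.code y ≤ s * F.code x) :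
    ∀ j < k, y j = i := by
  induction k generalizing x y with
  | zero => simp
  | succ k ih =>
    have hy0 : y 0 = i := by
      by_contra hne
      rw [F.code_eq y, F.code_eq x, hx 0 (by omega)] at hyx
      exact hyx.not_gt (hi _ hne _ (F.code_mem_X _) _ (F.code_mem_X _))
    have hyx' := (F.sign_mul_code_le_iff hs (n := 1) (by
      intro j hj
      obtain rfl : j = 0 := by omega
      rw [hy0, hx 0 (by omega)])).1 hyx
    have := ih (fun j hj => hx (j + 1) (by omega)) hyx'
    intro j hj
    cases j with
    | zero => exact hy0
    | succ j => exact this j (by omega)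

/-- A code strictly beyond the constant word would begin with iᵏ for every k, hence be that word.
Applied to -s and i', this shows that the tail i' i' … gives the far end of a cylinder. -/
theorem sign_mul_code_const_le (hs : s = 1 ∨ s = -1) {i : Fin (d + 1)}
    (hi : ∀ a, a ≠ i → ∀ u ∈ F.X, ∀ v ∈ F.X, s * F.f i u < s * F.f a v) (y : ℕ → Fin (d + 1)) :
    s * F.code (fun _ => i) ≤ s * F.code y := by
  by_contra! h
  have : y = fun _ => i := funext fun j =>
    F.agree_extremal hs hi (k := j + 1) (fun _ _ => rfl) h.le j (by omega)
  rw [this] at h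
  exact lt_irrefl _ h

/-- A code `e` is separated from the beginning of a cylinder: the points between `e` and a point
with an `i`-block of length `k` at level `m + 1` belong to the cylinder which ends with the block,
and all points of the cylinder with one more letter `i` are strictly between. -/
theorem exists_code_beside_block (hs : s = 1 ∨ s = -1) {i i' : Fin (d + 1)}
    (hi : ∀ a, a ≠ i → ∀ u ∈ F.X, ∀ v ∈ F.X, s * F.f i u < s * F.f a v)
    (hi' : ∀ a, a ≠ i' → ∀ u ∈ F.X, ∀ v ∈ F.X, s * F.f a u < s * F.f i' v)
    {x : ℕ → Fin (d + 1)} {m k : ℕ} (hm : x m ≠ i) (hk : x (m + 1 + k) ≠ i)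
    (hb : ∀ j < k, x (m + 1 + j) = i) :
    ∃ e : ℕ → Fin (d + 1), (∀ j < m, e j = x j) ∧ e m ≠ x m ∧ (∀ j, e (m + 1 + j) = i') ∧
      (∀ y, s * F.code e < s * F.code y → s * F.code y ≤ s * F.code x →
        ∀ j < m + 1 + k, y j = x j) ∧
      ∀ y, (∀ j < m + 1, y j = x j) → (∀ j < k + 1, y (m + 1 + j) = i) →
        s * F.code e < s * F.code y ∧ s * F.code y < s * F.code x := by
  obtain ⟨a, hab, halt, hac⟩ := F.exists_neighbor hs hi hm
  let e : ℕ → Fin (d + 1) := fun j => if j < m then x j else if j = m then a else i'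
  have he1 : ∀ j < m, e j = x j := fun j hj => by simp [e, hj]
  have he2 : e m = a := by simp [e]
  have he3 : ∀ j, e (m + 1 + j) = i' := fun j => by
    simp only [e]
    rw [if_neg (by omega), if_neg (by omega)]
  have hs' : -s = 1 ∨ -s = -1 := by
    rcases hs with rfl | rfl <;> simp
  have hlast : ∀ (z : ℕ → Fin (d + 1)), (shift^[m] z) 0 = z m := fun z => by
    rw [shift_iterate_apply]; rfl
  refine ⟨e, he1, by rwa [he2], he3, fun y hey hyx => ?_, fun y hy1 hy2 => ⟨?_, ?_⟩⟩
  · have hyj := F.agree_of_between hs he1 hey hyx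
    have hym : y m = x m := by
      have hey' := (F.sign_mul_code_lt_iff hs fun j hj => (he1 j hj).trans (hyj j hj).symm).1 hey
      have hyx' := (F.sign_mul_code_le_iff hs hyj).1 hyx
      by_contra hne
      -- A y in the cylinder of e cannot exceed e, whose tail i' i' … is maximal. With any other
      -- letter, y would lie between the neighbours a and `x m`.
      by_cases hya : y m = a
      · have h1 := (F.sign_mul_code_lt_iff hs (n := m + 1) (x := e) (y := y) (fun j hj => by
          rcases Nat.lt_succ_iff_lt_or_eq.1 hj with h | rfl
          · exact (he1 j h).trans (hyj j h).symm
          · rw [he2, hya])).1 hey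
        have h2 : shift^[m + 1] e = fun _ => i' := funext fun j => by
          rw [shift_iterate_apply, he3]
        have h3 := F.sign_mul_code_const_le hs' (i := i') (fun c hc u hu v hv => by
          have := hi' c hc v hv u hu
          linarith) (shift^[m + 1] y)
        rw [h2] at h1
        linarith
      · rw [F.code_eq (shift^[m] e), F.code_eq (shift^[m] y), hlast, hlast, he2] at hey'
        rw [F.code_eq (shift^[m] y), F.code_eq (shift^[m] x), hlast, hlast] at hyx'
        rcases hac _ hya hne with h | h
        · exact lt_asymm hey' (h _ (F.code_mem_X _) _ (F.code_mem_X _))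
        · exact hyx'.not_gt (h _ (F.code_mem_X _) _ (F.code_mem_X _))
    have hyj' : ∀ j < m + 1, y j = x j := fun j hj => by
      rcases Nat.lt_succ_iff_lt_or_eq.1 hj with h | rfl
      · exact hyj j h
      · exact hym
    have hyi := F.agree_extremal hs hi (k := k) (x := shift^[m + 1] x) (y := shift^[m + 1] y)
      (fun j hj => by rw [shift_iterate_apply, hb j hj])
      ((F.sign_mul_code_le_iff hs hyj').1 hyx)
    intro j hj
    by_cases hjm : j < m + 1
    · exact hyj' j hjm
    · obtain ⟨l, rfl⟩ := Nat.exists_eq_add_of_le (not_lt.1 hjm)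
      have := hyi l (by omega)
      rw [shift_iterate_apply] at this
      rw [this, hb l (by omega)]
  · rw [F.sign_mul_code_lt_iff hs fun j hj => (he1 j hj).trans (hy1 j (by omega)).symm,
      F.code_eq (shift^[m] e), F.code_eq (shift^[m] y), hlast, hlast, he2, hy1 m (by omega)]
    exact halt _ (F.code_mem_X _) _ (F.code_mem_X _)
  -- The first difference is the letter after the block: y has i there and x does not.
  · rw [F.sign_mul_code_lt_iff hs (n := m + 1 + k) (fun j hj => by
      by_cases hjm : j < m + 1
      · exact hy1 j hjm
      · obtain ⟨l, rfl⟩ := Nat.exists_eq_add_of_le (not_lt.1 hjm)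
        rw [hy2 l (by omega), hb l (by omega)]),
      F.code_eq (shift^[m + 1 + k] y), F.code_eq (shift^[m + 1 + k] x), shift_iterate_apply,
      shift_iterate_apply]
    simp only [add_zero]
    rw [hy2 k (by omega)]
    exact hi _ hk _ (F.code_mem_X _) _ (F.code_mem_X _)

end Order

/-! ### Bounded distortion and distances -/

section Distortion

theorem abs_log_sub_log_le {m p q : ℝ} (hm : 0 < m) (hp : m ≤ p) (hq : m ≤ q) :
    |Real.log p - Real.log q| ≤ |p - q| / m := by
  have key : ∀ a b : ℝ, m ≤ a → m ≤ b → Real.log a - Real.log b ≤ |a - b| / m := by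
    intro a b ha hb
    have ha' := hm.trans_le ha
    have hb' := hm.trans_le hb
    rw [← Real.log_div ha'.ne' hb'.ne']
    calc Real.log (a / b) ≤ a / b - 1 := Real.log_le_sub_one_of_pos (div_pos ha' hb')
      _ = (a - b) / b := by field_simp
      _ ≤ |a - b| / b := by gcongr; exact le_abs_self _
      _ ≤ |a - b| / m := by gcongr
  rw [abs_le]
  constructor
  · have := key q p hq hp
    rw [abs_sub_comm] at this
    linarith
  · exact key p q hp hq

variable {d : ℕ} (F : ConformalIFS d)

/-- The bounds come from compactness of X and the nonvanishing derivative of the continuation; the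
logarithm is Lipschitz away from zero, so the Hölder condition passes to log f'. -/
theorem exists_deriv_bounds : ∃ m M K ε : ℝ, 0 < m ∧ 0 ≤ K ∧ 0 < ε ∧ ∀ a,
    (∀ u ∈ interior F.X, m ≤ deriv (F.f a) u ∧ deriv (F.f a) u ≤ M) ∧
      ∀ u ∈ interior F.X, ∀ v ∈ interior F.X,
        |Real.log (deriv (F.f a) u) - Real.log (deriv (F.f a) v)| ≤ K * |u - v| ^ ε := by
  obtain ⟨ε, Y, hε, hY, -, hXY, hg⟩ := F.holder
  have one : ∀ a, ∃ m M H : ℝ, 0 < m ∧ 0 ≤ H ∧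
      (∀ u ∈ interior F.X, m ≤ deriv (F.f a) u ∧ deriv (F.f a) u ≤ M) ∧
      ∀ u ∈ interior F.X, ∀ v ∈ interior F.X,
        |deriv (F.f a) u - deriv (F.f a) v| ≤ H * |u - v| ^ (ε : ℝ) := by
    intro a
    obtain ⟨g, hgf, -, hgC, ⟨C, hC⟩, -, hg0⟩ := hg a
    have hd : ∀ u ∈ interior F.X, deriv (F.f a) u = deriv g u := fun u hu =>
      (hgf.symm.eventuallyEq_of_mem (mem_interior_iff_mem_nhds.1 hu)).deriv_eq
    -- The absolute value avoids determining the sign of `deriv g` on the boundary of X.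
    have hcont : ContinuousOn (fun u => |deriv g u|) F.X :=
      ((hgC.continuousOn_deriv_of_isOpen hY le_rfl).mono hXY).abs
    obtain ⟨p, hp, hpmin⟩ := F.isCompact_X.exists_isMinOn F.isConnected_X.nonempty hcont
    obtain ⟨q, hq, hqmax⟩ := F.isCompact_X.exists_isMaxOn F.isConnected_X.nonempty hcont
    refine ⟨|deriv g p|, |deriv g q|, C, abs_pos.2 (hg0 p (hXY hp)), C.2, fun u hu => ?_,
      fun u hu v hv => ?_⟩
    · have hpos := F.deriv_pos a u hu
      rw [← abs_of_pos hpos, hd u hu]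
      exact ⟨hpmin (interior_subset hu), hqmax (interior_subset hu)⟩
    · rw [hd u hu, hd v hv]
      exact hC.dist_le (hXY (interior_subset hu)) (hXY (interior_subset hv))
  choose m M H hm hH hb hHol using one
  obtain ⟨a₁, h₁⟩ := Finite.exists_min m
  obtain ⟨a₂, h₂⟩ := Finite.exists_max M
  obtain ⟨a₃, h₃⟩ := Finite.exists_max H
  refine ⟨m a₁, M a₂, H a₃ / m a₁, ε, hm _, div_nonneg (hH _) (hm _).le, hε,
    fun a => ⟨fun u hu => ⟨(h₁ a).trans (hb a u hu).1, (hb a u hu).2.trans (h₂ a)⟩,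
      fun u hu v hv => ?_⟩⟩
  refine (abs_log_sub_log_le (hm a₁) ((h₁ a).trans (hb a u hu).1)
    ((h₁ a).trans (hb a v hv).1)).trans ?_
  rw [div_mul_eq_mul_div]
  gcongr
  · exact (hm _).le
  · exact (hHol a u hu v hv).trans (by gcongr; exact h₃ a)

/-- Mean value theorem. The bound on |z - u| lets the Hölder estimate replace the derivative at z by
that at u. -/
theorem exists_deriv_mul_eq (a : Fin (d + 1)) {u v : ℝ} (hu : u ∈ interior F.X)
    (hv : v ∈ interior F.X) : ∃ z ∈ interior F.X, |z - u| ≤ |u - v| ∧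
      |F.f a u - F.f a v| = deriv (F.f a) z * |u - v| := by
  have hord : (interior F.X).OrdConnected :=
    (F.ordConnected_X.convex.interior).ordConnected
  have hdiff : ∀ z ∈ interior F.X, DifferentiableAt ℝ (F.f a) z := fun z hz =>
    differentiableAt_of_deriv_ne_zero (F.deriv_pos a z hz).ne'
  have key : ∀ p ∈ interior F.X, ∀ q ∈ interior F.X, p < q → ∃ z ∈ Ioo p q, z ∈ interior F.X ∧
      |F.f a q - F.f a p| = deriv (F.f a) z * |q - p| := by
    intro p hp q hq hpq
    have hsub : Icc p q ⊆ interior F.X := hord.out hp hq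
    obtain ⟨z, hz, hz'⟩ := exists_deriv_eq_slope (F.f a) hpq
      ((F.continuousOn_f a).mono (hsub.trans interior_subset))
      fun z hz => (hdiff z (hsub (Ioo_subset_Icc_self hz))).differentiableWithinAt
    have hzX := hsub (Ioo_subset_Icc_self hz)
    refine ⟨z, hz, hzX, ?_⟩
    rw [eq_div_iff (sub_pos.2 hpq).ne'] at hz'
    rw [← hz', abs_mul, abs_of_pos (F.deriv_pos a z hzX)]
  rcases lt_trichotomy u v with h | rfl | h
  · obtain ⟨z, hz, hzX, e⟩ := key u hu v hv h
    refine ⟨z, hzX, ?_, by rw [abs_sub_comm, e, abs_sub_comm]⟩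
    rw [abs_of_pos (sub_pos.2 hz.1), abs_sub_comm u, abs_of_pos (sub_pos.2 h)]
    linarith [hz.2]
  · exact ⟨u, hu, by simp, by simp⟩
  · obtain ⟨z, hz, hzX, e⟩ := key v hv u hu h
    refine ⟨z, hzX, ?_, e⟩
    rw [abs_sub_comm, abs_of_pos (sub_pos.2 hz.2), abs_of_pos (sub_pos.2 h)]
    linarith [hz.1]

theorem exists_abs_code_sub_le : ∃ q D : ℝ, 0 ≤ q ∧ q < 1 ∧ 0 ≤ D ∧
    ∀ (n : ℕ) (x y : ℕ → Fin (d + 1)), (∀ j < n, x j = y j) →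
      |F.code x - F.code y| ≤ D * q ^ n := by
  obtain ⟨c, hc1, hc⟩ := F.exists_ratio
  obtain ⟨D, hD⟩ := Metric.isBounded_iff.1 F.isCompact_X.isBounded
  refine ⟨c, D, c.2, by exact_mod_cast hc1,
    dist_nonneg.trans (hD (F.code_mem_X 0) (F.code_mem_X 0)), fun n x y h => ?_⟩
  have hw : (fun j : Fin n => x j) = fun j : Fin n => y j := funext fun j => h j j.2
  obtain ⟨u, hu, hu'⟩ := mem_iInter.1 (F.code_mem_nest x) n
  obtain ⟨v, hv, hv'⟩ := mem_iInter.1 (F.code_mem_nest y) n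
  have hle := (F.wordMap_lipschitz hc (List.ofFn fun j : Fin n => x j)).dist_le_mul u hu v hv
  rw [hu', hw, hv', Real.dist_eq, List.length_ofFn, NNReal.coe_pow] at hle
  rw [mul_comm]
  exact hle.trans (mul_le_mul_of_nonneg_left (hD hu hv) (by positivity))

/-- Summable variations give uniformly bounded variation of the Birkhoff sums on cylinders. -/
theorem abs_birkhoffSum_sub_le {g : (ℕ → Fin (d + 1)) → ℝ} {A θ : ℝ} (hA : 0 ≤ A) (hθ0 : 0 ≤ θ)
    (hθ : θ < 1) (hg : ∀ (n : ℕ) (x y : ℕ → Fin (d + 1)), (∀ j < n, x j = y j) →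
      |g x - g y| ≤ A * θ ^ n) {n : ℕ} {x y : ℕ → Fin (d + 1)} (h : ∀ j < n, x j = y j) :
    |birkhoffSum shift g n x - birkhoffSum shift g n y| ≤ A / (1 - θ) := by
  have h1 : 0 < 1 - θ := by linarith
  -- After j shifts the codes still agree on n - j letters, so the variations are dominated by a
  -- geometric sum; its closed form makes the induction work.
  have key : |birkhoffSum shift g n x - birkhoffSum shift g n y| ≤
      A / (1 - θ) * (1 - θ ^ (n + 1)) := by
    induction n generalizing x y with
    | zero => simpa using mul_nonneg (div_nonneg hA h1.le) h1.le
    | succ n ih =>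
      rw [birkhoffSum_succ', birkhoffSum_succ', add_sub_add_comm]
      refine (abs_add_le _ _).trans ((add_le_add (hg _ x y h)
        (ih (x := shift x) (y := shift y) fun j hj => h (j + 1) (by omega))).trans_eq ?_)
      field_simp
      ring
  refine key.trans (mul_le_of_le_one_right (div_nonneg hA h1.le) ?_)
  linarith [pow_nonneg hθ0 (n + 1)]

/-- Bounded distortion. -/
theorem exists_distortion : ∃ B : ℝ, ∀ (n : ℕ) (x y : ℕ → Fin (d + 1)), (∀ j < n, x j = y j) →
    Real.exp (birkhoffSum shift F.geomPotential n x - B) *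
        |F.code (shift^[n] x) - F.code (shift^[n] y)| ≤ |F.code x - F.code y| ∧
      |F.code x - F.code y| ≤ Real.exp (birkhoffSum shift F.geomPotential n x + B) *
        |F.code (shift^[n] x) - F.code (shift^[n] y)| := by
  obtain ⟨m, M, K, ε, hm, hK, hε, hb⟩ := F.exists_deriv_bounds
  obtain ⟨q, D, hq0, hq1, hD, hqD⟩ := F.exists_abs_code_sub_le
  set θ := q ^ ε with hθdef
  have hθ0 : 0 ≤ θ := Real.rpow_nonneg hq0 _
  have hθ1 : 0 < 1 - θ := sub_pos.2 (Real.rpow_lt_one hq0 hq1 hε)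
  set A := K * D ^ ε with hAdef
  have hA : 0 ≤ A := mul_nonneg hK (Real.rpow_nonneg hD _)
  -- One generator distorts by at most exp(Aθⁿ): the shifted codes agree on n letters, so their
  -- points are within D qⁿ. These errors are summed in `key`.
  have step : ∀ (n : ℕ) (x y : ℕ → Fin (d + 1)), (∀ j < n + 1, x j = y j) →
      Real.exp (F.geomPotential x - A * θ ^ n) * |F.code (shift x) - F.code (shift y)| ≤
        |F.code x - F.code y| ∧
      |F.code x - F.code y| ≤
        Real.exp (F.geomPotential x + A * θ ^ n) * |F.code (shift x) - F.code (shift y)| := by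
    intro n x y h
    have hu := F.code_mem_interior (shift x)
    obtain ⟨z, hz, hzu, e⟩ := F.exists_deriv_mul_eq (x 0) hu (F.code_mem_interior (shift y))
    have hlog := (hb (x 0)).2 z hz _ hu
    have hle : K * |z - F.code (shift x)| ^ ε ≤ A * θ ^ n := by
      have h1 : |z - F.code (shift x)| ≤ D * q ^ n :=
        hzu.trans (hqD n (shift x) (shift y) fun j hj => h (j + 1) (by omega))
      have h2 : |z - F.code (shift x)| ^ ε ≤ (D * q ^ n) ^ ε :=
        Real.rpow_le_rpow (abs_nonneg _) h1 hε.le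
      rw [Real.mul_rpow hD (pow_nonneg hq0 n), ← Real.rpow_natCast, ← Real.rpow_mul hq0,
        mul_comm (n : ℝ), Real.rpow_mul hq0, Real.rpow_natCast] at h2
      rw [hAdef, mul_assoc]
      exact mul_le_mul_of_nonneg_left h2 hK
    have hlog' := abs_le.1 (hlog.trans hle)
    rw [F.code_eq x, F.code_eq y, ← h 0 (by omega), e, ← Real.exp_log (F.deriv_pos _ z hz)]
    have hφ : F.geomPotential x = Real.log (deriv (F.f (x 0)) (F.code (shift x))) := rfl
    rw [hφ]
    constructor
    · gcongr
      linarith [hlog'.1]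
    · gcongr
      linarith [hlog'.2]
  have key : ∀ (n : ℕ) (x y : ℕ → Fin (d + 1)), (∀ j < n, x j = y j) →
      Real.exp (birkhoffSum shift F.geomPotential n x - A / (1 - θ) * (1 - θ ^ n)) *
          |F.code (shift^[n] x) - F.code (shift^[n] y)| ≤ |F.code x - F.code y| ∧
        |F.code x - F.code y| ≤
          Real.exp (birkhoffSum shift F.geomPotential n x + A / (1 - θ) * (1 - θ ^ n)) *
          |F.code (shift^[n] x) - F.code (shift^[n] y)| := by
    intro n
    induction n with
    | zero => intro x y _; simp
    | succ n ih =>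
      intro x y h
      obtain ⟨i1, i2⟩ := ih (shift x) (shift y) fun j hj => h (j + 1) (by omega)
      obtain ⟨s1, s2⟩ := step n x y h
      have hB : A / (1 - θ) * (1 - θ ^ (n + 1)) = A * θ ^ n + A / (1 - θ) * (1 - θ ^ n) := by
        field_simp
        ring
      rw [birkhoffSum_succ', Function.iterate_succ_apply, Function.iterate_succ_apply, hB]
      constructor
      · refine le_trans ?_ ((mul_le_mul_of_nonneg_left i1 (Real.exp_pos _).le).trans s1)
        rw [← mul_assoc, ← Real.exp_add]
        exact le_of_eq (by ring_nf)
      · refine (s2.trans (mul_le_mul_of_nonneg_left i2 (Real.exp_pos _).le)).trans ?_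
        rw [← mul_assoc, ← Real.exp_add]
        exact le_of_eq (by ring_nf)
  refine ⟨A / (1 - θ), fun n x y h => ?_⟩
  obtain ⟨h1, h2⟩ := key n x y h
  have hle : A / (1 - θ) * (1 - θ ^ n) ≤ A / (1 - θ) :=
    mul_le_of_le_one_right (div_nonneg hA hθ1.le) (by linarith [pow_nonneg hθ0 n])
  constructor
  · refine le_trans ?_ h1
    gcongr
  · refine h2.trans ?_
    gcongr

/-- A uniform gap between points whose first letters differ. -/
theorem exists_gap : ∃ δ : ℝ, 0 < δ ∧ ∀ x y : ℕ → Fin (d + 1), x 0 ≠ y 0 →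
    δ ≤ |F.code x - F.code y| := by
  have hc : ∀ a, IsCompact (F.f a '' F.X) := fun a =>
    F.isCompact_X.image_of_continuousOn (F.continuousOn_f a)
  have one : ∀ p : Fin (d + 1) × Fin (d + 1), ∃ r : ℝ, 0 < r ∧ (p.1 ≠ p.2 →
      ∀ u ∈ F.f p.1 '' F.X, ∀ v ∈ F.f p.2 '' F.X, r < |u - v|) := by
    rintro ⟨a, b⟩
    by_cases hab : a = b
    · exact ⟨1, one_pos, fun h => absurd hab h⟩
    · obtain ⟨r, hr, h⟩ := Metric.exists_pos_forall_lt_edist (hc a) (hc b).isClosed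
        (F.separation a b hab)
      refine ⟨r, hr, fun _ u hu v hv => ?_⟩
      have := h u hu v hv
      rw [edist_nndist, ENNReal.coe_lt_coe] at this
      rw [← Real.dist_eq]
      exact_mod_cast this
  choose r hr h using one
  obtain ⟨p, hp⟩ := Finite.exists_min r
  refine ⟨r p, hr p, fun x y hxy => (hp (x 0, y 0)).trans (h (x 0, y 0) hxy _ ?_ _ ?_).le⟩
  · rw [F.code_eq x]
    exact mem_image_of_mem _ (F.code_mem_X _)
  · rw [F.code_eq y]
    exact mem_image_of_mem _ (F.code_mem_X _)

/-- The distance of two points whose codes agree on exactly `m` letters. -/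
theorem exists_abs_code_sub_bounds : ∃ A : ℝ, 0 < A ∧ ∀ (m : ℕ) (x y : ℕ → Fin (d + 1)),
    (∀ j < m, x j = y j) → x m ≠ y m →
      A⁻¹ * Real.exp (birkhoffSum shift F.geomPotential (m + 1) x) ≤ |F.code x - F.code y| ∧
      |F.code x - F.code y| ≤ A * Real.exp (birkhoffSum shift F.geomPotential (m + 1) x) := by
  obtain ⟨l, M, K, ε, hl, -, -, hb⟩ := F.exists_deriv_bounds
  obtain ⟨q, D, -, -, hD, hqD⟩ := F.exists_abs_code_sub_le
  obtain ⟨B, hB⟩ := F.exists_distortion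
  obtain ⟨δ, hδ, hgap⟩ := F.exists_gap
  -- Passing from m to m + 1 terms of the Birkhoff sum costs only a factor between l and M.
  have hφ : ∀ x, l ≤ Real.exp (F.geomPotential x) ∧ Real.exp (F.geomPotential x) ≤ M := by
    intro x
    have hx := F.code_mem_interior (shift x)
    rw [geomPotential, Real.exp_log (F.deriv_pos _ _ hx)]
    exact (hb (x 0)).1 _ hx
  have hM : 0 < M := (Real.exp_pos _).trans_le (hφ 0).2
  have hA1 : 0 < Real.exp B * M / δ := by positivity
  have hA2 : 0 ≤ Real.exp B * D / l := by positivity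
  refine ⟨Real.exp B * M / δ + Real.exp B * D / l, by positivity, fun m x y h hne => ?_⟩
  obtain ⟨h1, h2⟩ := hB m x y h
  obtain ⟨p1, p2⟩ := hφ (shift^[m] x)
  have hgap' := hgap (shift^[m] x) (shift^[m] y) (by
    simpa only [shift_iterate_apply, add_zero] using hne)
  have hD' : |F.code (shift^[m] x) - F.code (shift^[m] y)| ≤ D := by
    simpa using hqD 0 (shift^[m] x) (shift^[m] y) (by simp)
  rw [birkhoffSum_succ, Real.exp_add]
  rw [Real.exp_sub] at h1
  rw [Real.exp_add] at h2
  set E := Real.exp (birkhoffSum shift F.geomPotential m x) with hE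
  have hE0 : 0 < E := Real.exp_pos _
  set P := Real.exp (F.geomPotential (shift^[m] x)) with hP
  have hB0 := Real.exp_pos B
  constructor
  · calc _ ≤ (Real.exp B * M / δ)⁻¹ * (E * M) := by gcongr; linarith
      _ = E / Real.exp B * δ := by field_simp
      _ ≤ _ := by refine le_trans ?_ h1; gcongr
  · calc _ ≤ E * Real.exp B * D := by refine h2.trans ?_; gcongr
      _ = Real.exp B * D / l * (E * l) := by field_simp
      _ ≤ _ := by gcongr; linarith

end Distortion

/-! ### Gibbs measure of the interval between ξ and η -/

section Measure

open MeasureTheory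

theorem abs_cdf_sub_cdf (ν : Measure ℝ) [IsProbabilityMeasure ν] (a b : ℝ) :
    |ProbabilityTheory.cdf ν a - ProbabilityTheory.cdf ν b| = ν.real (uIoc a b) := by
  wlog hab : a ≤ b generalizing a b
  · rw [abs_sub_comm, uIoc_comm]
    exact this b a (le_of_not_ge hab)
  rw [uIoc_of_le hab, ← Iic_sdiff_Iic, measureReal_sdiff (Iic_subset_Iic.2 hab) measurableSet_Iic,
    ProbabilityTheory.cdf_eq_real, ProbabilityTheory.cdf_eq_real, abs_sub_comm, abs_of_nonneg]
  exact sub_nonneg.2 (measureReal_mono (Iic_subset_Iic.2 hab))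

variable {d : ℕ}

theorem birkhoffSum_shift_const (g : (ℕ → Fin (d + 1)) → ℝ) (i : Fin (d + 1)) (n : ℕ) :
    birkhoffSum shift g n (fun _ => i) = n * g fun _ => i := by
  have h : Function.IsFixedPt shift (fun _ : ℕ => i) := rfl
  rw [h.birkhoffSum_eq, nsmul_eq_mul]

theorem birkhoffSum_eventually_const (g : (ℕ → Fin (d + 1)) → ℝ) {i : Fin (d + 1)}
    {x : ℕ → Fin (d + 1)} {n : ℕ} (hx : ∀ j, x (n + j) = i) (l : ℕ) :
    birkhoffSum shift g (n + l) x = birkhoffSum shift g n x + l * g fun _ => i := by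
  have h : shift^[n] x = fun _ => i := funext fun j => by rw [shift_iterate_apply, hx]
  rw [birkhoffSum_add, h, birkhoffSum_shift_const]

variable (F : ConformalIFS d)

theorem birkhoffSum_chi (ψ : ℝ → ℝ) (α : ℝ) (n : ℕ) (x : ℕ → Fin (d + 1)) :
    birkhoffSum shift (F.chi ψ α) n x =
      birkhoffSum shift (F.lift ψ) n x - α * birkhoffSum shift F.geomPotential n x := by
  simp only [birkhoffSum, chi, Finset.sum_sub_distrib, Finset.mul_sum]

theorem exists_birkhoffSum_lift_variation {ψ : ℝ → ℝ}
    (hψ : ∃ C r : NNReal, 0 < r ∧ HolderOnWith C r ψ F.limitSet) :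
    ∃ V : ℝ, ∀ (n : ℕ) (x y : ℕ → Fin (d + 1)), (∀ j < n, x j = y j) →
      |birkhoffSum shift (F.lift ψ) n x - birkhoffSum shift (F.lift ψ) n y| ≤ V := by
  obtain ⟨C, r, hr, hC⟩ := hψ
  obtain ⟨q, D, hq0, hq1, hD, hqD⟩ := F.exists_abs_code_sub_le
  refine ⟨_, fun n x y h => abs_birkhoffSum_sub_le (A := C * D ^ (r : ℝ)) (θ := q ^ (r : ℝ))
    (mul_nonneg C.2 (Real.rpow_nonneg hD _)) (Real.rpow_nonneg hq0 _)
    (Real.rpow_lt_one hq0 hq1 hr) (fun n x y h => ?_) h⟩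
  refine (hC.dist_le (F.code_mem_limitSet x) (F.code_mem_limitSet y)).trans ?_
  have h2 : |F.code x - F.code y| ^ (r : ℝ) ≤ (D * q ^ n) ^ (r : ℝ) :=
    Real.rpow_le_rpow (abs_nonneg _) (hqD n x y h) r.2
  rw [Real.mul_rpow hD (pow_nonneg hq0 n), ← Real.rpow_natCast, ← Real.rpow_mul hq0,
    mul_comm (n : ℝ), Real.rpow_mul hq0, Real.rpow_natCast] at h2
  rw [mul_assoc]
  exact mul_le_mul_of_nonneg_left h2 C.2

variable {F}

/-- A Gibbs measure of a negative potential has no atom at an eventually constant code. -/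
theorem IsGibbs.measureReal_singleton {ψ : ℝ → ℝ} {ν : Measure ℝ} (hν : F.IsGibbs ψ ν)
    (hneg : ∀ x, F.lift ψ x < 0) {i : Fin (d + 1)} {x : ℕ → Fin (d + 1)} {n : ℕ}
    (hx : ∀ j, x (n + j) = i) : ν.real {F.code x} = 0 := by
  have := hν.prob
  obtain ⟨C, hC, hG⟩ := hν.gibbs
  set b := F.lift ψ fun _ => i with hb
  -- The point lies in cylinders whose measure decays like exp(b)ˡ, and b < 0.
  have hle : ∀ l : ℕ, ν.real {F.code x} ≤
      C * Real.exp (birkhoffSum shift (F.lift ψ) n x) * Real.exp b ^ l := by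
    intro l
    have hmem : x ∈ cylinder fun j : Fin (n + l) => x j := fun j => rfl
    refine (measureReal_mono (singleton_subset_iff.2 (mem_image_of_mem _ hmem))).trans
      ((hG _ _ x hmem).2.trans_eq ?_)
    rw [birkhoffSum_eventually_const _ hx, Real.exp_add, Real.exp_nat_mul, mul_assoc]
  have hlim := (tendsto_pow_atTop_nhds_zero_of_lt_one (Real.exp_pos b).le
    (by simpa using hneg fun _ => i)).const_mul (C * Real.exp (birkhoffSum shift (F.lift ψ) n x))
  rw [mul_zero] at hlim
  exact le_antisymm (ge_of_tendsto' hlim hle) measureReal_nonneg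

/-- The measure between the two points is comparable to the measure of the cylinder that ends
with the block. -/
theorem IsGibbs.exists_bounds {ψ : ℝ → ℝ} {ν : Measure ℝ} (hν : F.IsGibbs ψ ν)
    (hψ : ∃ C r : NNReal, 0 < r ∧ HolderOnWith C r ψ F.limitSet)
    (hneg : ∀ x, F.lift ψ x < 0) :
    ∃ B : ℝ, 0 < B ∧ ∀ s : ℝ, (s = 1 ∨ s = -1) → ∀ i i' : Fin (d + 1),
      (∀ a, a ≠ i → ∀ u ∈ F.X, ∀ v ∈ F.X, s * F.f i u < s * F.f a v) →
      (∀ a, a ≠ i' → ∀ u ∈ F.X, ∀ v ∈ F.X, s * F.f a u < s * F.f i' v) →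
      ∀ (x : ℕ → Fin (d + 1)) (m k : ℕ), x m ≠ i → x (m + 1 + k) ≠ i →
        (∀ j < k, x (m + 1 + j) = i) →
        ∃ e : ℕ → Fin (d + 1), (∀ j < m, x j = e j) ∧ x m ≠ e m ∧
          B⁻¹ * (Real.exp (birkhoffSum shift (F.lift ψ) (m + 1) x) *
            Real.exp (k * F.lift ψ fun _ => i)) ≤ ν.real (uIoc (F.code x) (F.code e)) ∧
          ν.real (uIoc (F.code x) (F.code e)) ≤
            B * (Real.exp (birkhoffSum shift (F.lift ψ) (m + 1) x) *
              Real.exp (k * F.lift ψ fun _ => i)) := by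
  have := hν.prob
  obtain ⟨C, hC, hG⟩ := hν.gibbs
  obtain ⟨V, hV⟩ := F.exists_birkhoffSum_lift_variation hψ
  -- The minimum P over constant words bounds the cost of the additional letter i in iᵏ⁺¹, uniformly
  -- in i.
  obtain ⟨a₀, ha₀⟩ := Finite.exists_min fun a : Fin (d + 1) => F.lift ψ fun _ => a
  set P := F.lift ψ fun _ => a₀ with hPdef
  refine ⟨C * Real.exp (V - P), by positivity, fun s hs i i' hi hi' x m k hm hk hb => ?_⟩
  obtain ⟨e, he1, he2, he3, hin, hout⟩ := F.exists_code_beside_block hs hi hi' hm hk hb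
  -- The word x₁…xₙ i i i …, at which the Birkhoff sum along the block is exact.
  let z : ℕ → Fin (d + 1) := fun j => if j < m + 1 then x j else i
  have hz1 : ∀ j < m + 1, z j = x j := fun j hj => if_pos hj
  have hz2 : ∀ j, z (m + 1 + j) = i := fun j => if_neg (by omega)
  refine ⟨e, fun j hj => (he1 j hj).symm, he2.symm, ?_, ?_⟩
  · have hsub : F.code '' (cylinder fun j : Fin (m + 1 + (k + 1)) => z j) ⊆
        uIoc (F.code x) (F.code e) := by
      rintro _ ⟨y, hy, rfl⟩
      have hy' : ∀ j < m + 1 + (k + 1), y j = z j := fun j hj => hy ⟨j, hj⟩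
      obtain ⟨h1, h2⟩ := hout y (fun j hj => (hy' j (by omega)).trans (hz1 j hj))
        fun j hj => (hy' _ (by omega)).trans (hz2 j)
      rw [mem_uIoc]
      rcases hs with rfl | rfl
      · right; constructor <;> linarith
      · left; constructor <;> linarith
    refine le_trans ?_ ((hG _ _ z fun j => rfl).1.trans (measureReal_mono hsub))
    rw [birkhoffSum_eventually_const _ hz2, mul_inv, ← Real.exp_neg, mul_assoc, ← Real.exp_add,
      ← Real.exp_add]
    have h1 := (abs_le.1 (hV (m + 1) z x hz1)).1
    have h2 := ha₀ i
    refine mul_le_mul_of_nonneg_left (Real.exp_le_exp.2 ?_) (inv_pos.2 hC).le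
    push_cast
    linarith
  -- The half-open interval contains the point of e when s = -1, hence the singleton, which is null.
  · have hsub : uIoc (F.code x) (F.code e) ⊆
        F.code '' (cylinder fun j : Fin (m + 1 + k) => x j) ∪ ({F.code e} ∪ F.limitSetᶜ) := by
      intro p hp
      by_cases hpL : p ∈ F.limitSet
      swap
      · exact Or.inr (Or.inr hpL)
      obtain ⟨y, rfl⟩ := F.exists_code_eq hpL
      by_cases hpe : F.code y = F.code e
      · exact Or.inr (Or.inl hpe)
      refine Or.inl ⟨y, ?_, rfl⟩
      have hex : s * F.code e < s * F.code x := by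
        obtain ⟨h1, h2⟩ := hout z hz1 fun j _ => hz2 j
        exact h1.trans h2
      have hbet : s * F.code e < s * F.code y ∧ s * F.code y ≤ s * F.code x := by
        rw [mem_uIoc] at hp
        rcases hs with rfl | rfl
        · rcases hp with hp | hp
          · linarith
          · constructor <;> linarith
        · rcases hp with hp | hp
          · have := lt_of_le_of_ne hp.2 hpe
            constructor <;> linarith
          · linarith
      exact fun j => hin y hbet.1 hbet.2 j j.2
    have h0 : ν.real F.limitSetᶜ = 0 := by simp [Measure.real, hν.carried]
    have hUle : ν.real (uIoc (F.code x) (F.code e)) ≤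
        ν.real (F.code '' (cylinder fun j : Fin (m + 1 + k) => x j)) := by
      refine (measureReal_mono hsub).trans ((measureReal_union_le _ _).trans ?_)
      have := measureReal_union_le (μ := ν) {F.code e} F.limitSetᶜ
      rw [hν.measureReal_singleton hneg he3, h0] at this
      linarith
    refine hUle.trans ((hG _ _ x fun j => rfl).2.trans ?_)
    have hk' := (abs_le.1 (hV k (shift^[m + 1] x) (fun _ => i) fun j hj => by
      rw [shift_iterate_apply, hb j hj])).2
    rw [birkhoffSum_shift_const] at hk'
    -- As exp(-P) > 1, the constant of the lower bound also serves here.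
    have hP0 : P < 0 := hneg _
    rw [birkhoffSum_add, mul_assoc, ← Real.exp_add, ← Real.exp_add]
    refine mul_le_mul_of_nonneg_left (Real.exp_le_exp.2 ?_) hC.le
    linarith

end Measure

theorem div_rpow_bounds {A B E G r M α : ℝ} (hA : 0 < A) (hB : 0 < B) (hE : 0 < E) (hG : 0 < G)
    (hα : 0 < α) (h1 : A⁻¹ * E ≤ r) (h2 : r ≤ A * E) (h3 : B⁻¹ * G ≤ M) (h4 : M ≤ B * G) :
    (B * A ^ α)⁻¹ * (G / E ^ α) ≤ M / r ^ α ∧ M / r ^ α ≤ B * A ^ α * (G / E ^ α) := by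
  have hr : 0 < r := lt_of_lt_of_le (by positivity) h1
  have hM : 0 < M := lt_of_lt_of_le (by positivity) h3
  have hAα : 0 < A ^ α := Real.rpow_pos_of_pos hA _
  have hEα : 0 < E ^ α := Real.rpow_pos_of_pos hE _
  have hrα : 0 < r ^ α := Real.rpow_pos_of_pos hr _
  have u1 : (A ^ α)⁻¹ * E ^ α ≤ r ^ α := by
    rw [← Real.inv_rpow hA.le, ← Real.mul_rpow (by positivity) hE.le]
    exact Real.rpow_le_rpow (by positivity) h1 hα.le
  have u2 : r ^ α ≤ A ^ α * E ^ α := by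
    rw [← Real.mul_rpow hA.le hE.le]
    exact Real.rpow_le_rpow hr.le h2 hα.le
  constructor
  · calc _ = (B⁻¹ * G) / (A ^ α * E ^ α) := by field_simp
      _ ≤ _ := by gcongr
  · calc M / r ^ α ≤ (B * G) / ((A ^ α)⁻¹ * E ^ α) := by gcongr
      _ = _ := by field_simp

end ConformalIFS

theorem proposition2p2 {d : ℕ} (hd : 1 ≤ d) (F : ConformalIFS d) (α : ℝ) (hα : 0 < α)
    (ψ : ℝ → ℝ) (hψ : ∃ C r : NNReal, 0 < r ∧ HolderOnWith C r ψ F.limitSet)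
    (hneg : ∀ x, F.lift ψ x < 0) (hP : ConformalIFS.HasPressure (F.lift ψ) 0)
    (hαψ : ∀ x, α * F.geomPotential x < F.lift ψ x)
    (ν : MeasureTheory.Measure ℝ) (hν : F.IsGibbs ψ ν) :
    ∃ C : ℝ, 0 < C ∧ ∀ i : Fin (d + 1), (i = 0 ∨ i = 1) →
      ∀ (x : ℕ → Fin (d + 1)) (n k : ℕ), ConformalIFS.HasBlock x i k n →
        ∃ η ∈ F.limitSet,
          (C⁻¹ * Real.exp (birkhoffSum ConformalIFS.shift F.geomPotential n x)
              ≤ |F.code x - η| ∧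
            |F.code x - η|
              ≤ C * Real.exp (birkhoffSum ConformalIFS.shift F.geomPotential n x)) ∧
          (C⁻¹ * (Real.exp (birkhoffSum ConformalIFS.shift (F.chi ψ α) n x)
                * Real.exp (k * ψ (F.code fun _ => i)))
              ≤ |ProbabilityTheory.cdf ν (F.code x) - ProbabilityTheory.cdf ν η|
                / |F.code x - η| ^ α ∧
            |ProbabilityTheory.cdf ν (F.code x) - ProbabilityTheory.cdf ν η|
                / |F.code x - η| ^ α
              ≤ C * (Real.exp (birkhoffSum ConformalIFS.shift (F.chi ψ α) n x)
                * Real.exp (k * ψ (F.code fun _ => i)))) := by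
  have := hν.prob
  obtain ⟨A, hA, hdist⟩ := F.exists_abs_code_sub_bounds
  obtain ⟨B, hB, hmeas⟩ := hν.exists_bounds hψ hneg
  have hBA : 0 < B * A ^ α := mul_pos hB (Real.rpow_pos_of_pos hA _)
  refine ⟨A + B * A ^ α, by positivity, fun i hi x n k hblock => ?_⟩
  obtain ⟨hn, -, hx1, hx2, hx3⟩ := hblock
  -- With n = m + 1 and indices from zero, xₙ is `x m` and the block occupies the positions m + 1,
  -- …, m + k.
  obtain ⟨m, rfl⟩ := Nat.exists_eq_add_of_le' hn
  have hxb : ∀ j < k, x (m + 1 + j) = i := fun j hj => hx3 (j + 1) (by omega) (by omega)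
  obtain ⟨e, he1, he2, he3, he4⟩ : ∃ e : ℕ → Fin (d + 1), (∀ j < m, x j = e j) ∧ x m ≠ e m ∧
      B⁻¹ * (Real.exp (birkhoffSum ConformalIFS.shift (F.lift ψ) (m + 1) x) *
        Real.exp (k * F.lift ψ fun _ => i)) ≤ ν.real (Set.uIoc (F.code x) (F.code e)) ∧
      ν.real (Set.uIoc (F.code x) (F.code e)) ≤
        B * (Real.exp (birkhoffSum ConformalIFS.shift (F.lift ψ) (m + 1) x) *
          Real.exp (k * F.lift ψ fun _ => i)) := by
    have hl : ∀ a, a ≠ 0 → ∀ u ∈ F.X, ∀ v ∈ F.X, F.f 0 u < F.f a v := fun a ha u hu v hv =>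
      F.label_left a ha _ (Set.mem_image_of_mem _ hu) _ (Set.mem_image_of_mem _ hv)
    have hr : ∀ a, a ≠ 1 → ∀ u ∈ F.X, ∀ v ∈ F.X, F.f a u < F.f 1 v := fun a ha u hu v hv =>
      F.label_right a ha _ (Set.mem_image_of_mem _ hv) _ (Set.mem_image_of_mem _ hu)
    -- For i = 0 the neighbour lies to the left and η ends in 1 1 1 …; for i = 1 the picture is
    -- reflected.
    rcases hi with rfl | rfl
    · exact hmeas 1 (Or.inl rfl) 0 1 (by simpa using hl) (by simpa using hr) x m k hx1 hx2 hxb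
    · refine hmeas (-1) (Or.inr rfl) 1 0 (fun a ha u hu v hv => ?_) (fun a ha u hu v hv => ?_)
        x m k hx1 hx2 hxb
      · linarith [hr a ha v hv u hu]
      · linarith [hl a ha v hv u hu]
  obtain ⟨d1, d2⟩ := hdist m x e he1 he2
  refine ⟨F.code e, F.code_mem_limitSet e, ⟨?_, ?_⟩, ?_⟩
  · refine le_trans ?_ d1
    gcongr
    linarith
  · refine d2.trans ?_
    gcongr
    linarith
  obtain ⟨r1, r2⟩ := ConformalIFS.div_rpow_bounds hA hB (Real.exp_pos _) (by positivity) hα d1 d2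
    he3 he4
  have hG : Real.exp (birkhoffSum ConformalIFS.shift (F.chi ψ α) (m + 1) x) *
      Real.exp (k * ψ (F.code fun _ => i)) =
      Real.exp (birkhoffSum ConformalIFS.shift (F.lift ψ) (m + 1) x) *
        Real.exp (k * F.lift ψ fun _ => i) /
        Real.exp (birkhoffSum ConformalIFS.shift F.geomPotential (m + 1) x) ^ α := by
    rw [F.birkhoffSum_chi, Real.exp_sub, ← Real.exp_mul, mul_comm α, div_mul_eq_mul_div]
    rfl
  rw [ConformalIFS.abs_cdf_sub_cdf, hG]
  constructor
  · refine le_trans ?_ r1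
    gcongr
    linarith
  · refine r2.trans ?_
    gcongr
    linarith
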